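/- Let $\mathbb D$ be the open unit disc and let $H^2(\mathbb D)$ be the Hardy space of functions $f(z)=\sum_{k\ge 0}a_kz^k$ on $\mathbb D$ with $\|f\|^2=\sum_{k\ge 0}|a_k|^2<\infty$, with the inner product $\langle f,g\rangle=\sum_{k\ge 0} a_k\overline{b_k}$ for $g(z)=\sum_{k\ge 0} b_kz^k$. Let $\varphi_1,\dots,\varphi_n:\mathbb D\to\mathbb D$ be analytic, none of them the identity map of $\mathbb D$, and let $\psi_1,\dots,\psi_n:\mathbb D\to\mathbb C$ be analytic. Suppose that the sum of weighted composition operators $$M_{\psi,\varphi}f=\sum_{j=1}^n C_{\psi_j,\varphi_j}f=\sum_{j=1}^n\psi_j\cdot(f\circ\varphi_j)$$ maps $H^2(\mathbb D)$ into itself (equivalently, by the closed graph theorem, that $M_{\psi,\varphi}$ is a bounded operator on $H^2(\mathbb D)$). Then $0$ lies in the closure of the numerical range $W(M_{\psi,\varphi})=\{\langle M_{\psi,\varphi}f,f\rangle : f\in H^2(\mathbb D),\ \|f\|=1\}$. -/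

import Mathlib

open scoped Complex.UnitDisc

noncomputable section

/-- A complex-valued function on the open unit disc `𝔻` is analytic if it is the restriction to the
disc of a function on `ℂ` that is analytic at every point of the disc. -/
def IsAnalyticOnDisc (f : 𝔻 → ℂ) : Prop :=
  ∃ g : ℂ → ℂ, AnalyticOnNhd ℂ g (Metric.ball 0 1) ∧ ∀ z : 𝔻, f z = g z

/-- The space `ℓ²(ℕ, ℂ)` of square-summable complex sequences. -/
abbrev SquareSummableSeq : Type := lp (fun _ : ℕ => ℂ) 2

theorem SquareSummableSeq.norm_coeff_le (a : SquareSummableSeq) (n : ℕ) : ‖a n‖ ≤ ‖a‖ :=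
  lp.norm_apply_le_norm (by norm_num) a n

theorem SquareSummableSeq.summable (a : SquareSummableSeq) {z : ℂ} (hz : ‖z‖ < 1) :
    Summable fun n => a n * z ^ n := by
  refine Summable.of_norm_bounded
    ((summable_geometric_of_lt_one (norm_nonneg z) hz).mul_left ‖a‖) fun n => ?_
  rw [norm_mul, norm_pow]
  exact mul_le_mul_of_nonneg_right (a.norm_coeff_le n) (by positivity)

/-- The linear map sending a square-summable sequence `a` to the function `z ↦ ∑ aₙ zⁿ` on `𝔻`. -/
def powerSeriesMap : SquareSummableSeq →ₗ[ℂ] (𝔻 → ℂ) where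
  toFun a z := ∑' n, a n * (z : ℂ) ^ n
  map_add' a b := by
    ext z
    simp only [Pi.add_apply, lp.coeFn_add, add_mul]
    exact (a.summable z.norm_lt_one).tsum_add (b.summable z.norm_lt_one)
  map_smul' c a := by
    ext z
    simp only [Pi.smul_apply, lp.coeFn_smul, smul_eq_mul, RingHom.id_apply, mul_assoc]
    exact tsum_mul_left

theorem powerSeriesMap_injective : Function.Injective powerSeriesMap := by
  rw [← LinearMap.ker_eq_bot, LinearMap.ker_eq_bot']
  intro a ha
  have hp : HasFPowerSeriesOnBall (fun z : ℂ => ∑' n, a n * z ^ n)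
      (FormalMultilinearSeries.ofScalars ℂ (fun n => a n)) 0 1 := by
    refine ⟨?_, one_pos, ?_⟩
    · refine FormalMultilinearSeries.le_radius_of_bound _ ‖a‖ fun n => ?_
      simpa using a.norm_coeff_le n
    · intro y hy
      have hy' : ‖y‖ < 1 := by
        have h := Metric.mem_eball.1 hy
        rw [edist_zero_right, ← ofReal_norm] at h
        exact ENNReal.ofReal_lt_one.1 h
      simpa [FormalMultilinearSeries.ofScalars_apply_eq, mul_comm] using (a.summable hy').hasSum
  have h0 : (fun z : ℂ => ∑' n, a n * z ^ n) =ᶠ[nhds 0] fun _ => 0 := by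
    filter_upwards [Metric.ball_mem_nhds (0 : ℂ) one_pos] with z hz
    exact congrFun ha (Complex.UnitDisc.mk z (by simpa using hz))
  have hz := (hp.hasFPowerSeriesAt.congr h0).eq_zero
  ext n
  have hn := congrArg (fun p : FormalMultilinearSeries ℂ ℂ ℂ => p.coeff n) hz
  have h1 : (0 : FormalMultilinearSeries ℂ ℂ ℂ).coeff n = 0 := rfl
  simp only [FormalMultilinearSeries.coeff_ofScalars, h1] at hn
  exact hn

/-- The functions on `𝔻` of the form `z ↦ ∑ aₙ zⁿ` with `∑ |aₙ|² < ∞`. -/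
def hardySubmodule : Submodule ℂ (𝔻 → ℂ) := LinearMap.range powerSeriesMap

/-- The Hardy space `H²(𝔻)` of functions `f(z) = ∑ aₙ zⁿ` on `𝔻` with `∑ |aₙ|² < ∞`. It is kept
apart from the subtype `↥hardySubmodule`, so that it carries the topology of its norm and not
that of pointwise convergence. -/
def HardySpace : Type := ↥hardySubmodule

namespace HardySpace

instance instAddCommGroup : AddCommGroup HardySpace :=
  inferInstanceAs (AddCommGroup ↥hardySubmodule)

instance instModule : Module ℂ HardySpace := inferInstanceAs (Module ℂ ↥hardySubmodule)

instance instCoeFun : CoeFun HardySpace (fun _ => 𝔻 → ℂ) := ⟨fun f => Subtype.val f⟩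

/-- The sequence of Taylor coefficients at the origin of a function in the Hardy space. -/
def coeffs : HardySpace ≃ₗ[ℂ] SquareSummableSeq :=
  (LinearEquiv.ofInjective powerSeriesMap powerSeriesMap_injective).symm

theorem hasSum_coeffs (f : HardySpace) (z : 𝔻) :
    HasSum (fun n => coeffs f n * (z : ℂ) ^ n) (f z) := by
  have h : powerSeriesMap (coeffs f) = f :=
    congrArg Subtype.val
      ((LinearEquiv.ofInjective powerSeriesMap powerSeriesMap_injective).apply_symm_apply f)
  rw [← h]
  exact ((coeffs f).summable z.norm_lt_one).hasSum

/-- The norm of the Hardy space: `‖f‖² = ∑ |aₙ|²`. -/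
instance instNormedAddCommGroup : NormedAddCommGroup HardySpace :=
  NormedAddCommGroup.induced HardySpace SquareSummableSeq coeffs coeffs.injective

/-- The inner product of the Hardy space. Mathlib's inner products are conjugate-linear in the
first argument, so `inner ℂ f g = ∑ conj aₙ * bₙ` for `f = ∑ aₙ zⁿ` and `g = ∑ bₙ zⁿ`. -/
instance instInnerProductSpace : InnerProductSpace ℂ HardySpace where
  norm_smul_le c f := by
    change ‖coeffs (c • f)‖ ≤ ‖c‖ * ‖coeffs f‖
    rw [map_smul, norm_smul]
  inner f g := inner ℂ (coeffs f) (coeffs g)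
  norm_sq_eq_re_inner f := norm_sq_eq_re_inner (𝕜 := ℂ) (coeffs f)
  conj_inner_symm f g := inner_conj_symm (coeffs f) (coeffs g)
  add_left f g h := by
    change inner ℂ (coeffs (f + g)) (coeffs h) = _
    rw [map_add, inner_add_left]
  smul_left f g c := by
    change inner ℂ (coeffs (c • f)) (coeffs g) = _
    rw [map_smul, inner_smul_left]

end HardySpace

/-- The weighted composition operator `C_{ψ,φ} f = ψ · (f ∘ φ)` on functions on `𝔻`. -/
def weightedComp (ψ : 𝔻 → ℂ) (φ : 𝔻 → 𝔻) : (𝔻 → ℂ) →ₗ[ℂ] (𝔻 → ℂ) where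
  toFun f z := ψ z * f (φ z)
  map_add' f g := by
    ext z
    exact mul_add _ _ _
  map_smul' c f := by
    ext z
    exact mul_left_comm _ _ _

/-- The finite sum `M_{ψ,φ} = ∑ⱼ C_{ψⱼ,φⱼ}` on functions on `𝔻`. -/
def weightedCompSum {n : ℕ} (ψ : Fin n → 𝔻 → ℂ) (φ : Fin n → 𝔻 → 𝔻) :
    (𝔻 → ℂ) →ₗ[ℂ] (𝔻 → ℂ) :=
  ∑ j, weightedComp (ψ j) (φ j)

/-- The operator `M_{ψ,φ}` on the Hardy space, when it maps the Hardy space into itself. -/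
def weightedCompSumHardy {n : ℕ} (ψ : Fin n → 𝔻 → ℂ) (φ : Fin n → 𝔻 → 𝔻)
    (h : ∀ f ∈ hardySubmodule, weightedCompSum ψ φ f ∈ hardySubmodule) :
    HardySpace →ₗ[ℂ] HardySpace :=
  (weightedCompSum ψ φ).restrict h

/-- The numerical range `W(T) = {⟨T x, x⟩ : ‖x‖ = 1}`; the inner product `⟨T x, x⟩`, linear in its
first argument, is written `inner ℂ x (T x)` in Mathlib. -/
def numericalRange {E : Type*} [NormedAddCommGroup E] [InnerProductSpace ℂ E] (T : E →ₗ[ℂ] E) :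
    Set ℂ :=
  {w | ∃ x : E, ‖x‖ = 1 ∧ inner ℂ x (T x) = w}

end

/-!
The proof tests the operator `M` on the normalised reproducing kernels of the Hardy space.
Let `K_w(z) = 1 / (1 - conj w * z)`, so that `⟨f, K_w⟩ = f w` and `‖K_w‖² = 1 / (1 - |w|²)`. The
numerical range of `M` contains, for every `w` in the disc, the number `R w / ‖K_w‖²`, where
`R w = (M K_w) w = ∑ⱼ ψⱼ w / (1 - conj w * φⱼ w)`.

No growth condition on the individual weights `ψⱼ` is available, but the functions
`M zᵐ = ∑ⱼ ψⱼ φⱼᵐ` lie in the Hardy space and are therefore `O(‖K_w‖)` at `w`. For fixed `w`, the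
product `∏ᵢ (1 - conj w * φᵢ w)` times `1 / (1 - conj w * X)` agrees at the points `X = φⱼ w` with a
polynomial in `X` whose coefficients are bounded independently of `w`. Hence
`∏ᵢ |1 - conj w * φᵢ w| * |R w| ≤ C ‖K_w‖` (`exists_norm_prod_mul_resolvent_le`).

Since `|w - φᵢ w| ≤ |1 - conj w * φᵢ w|`, if the numerical range avoided the disc of radius `ε`
about `0`, then the analytic function `D z = ∏ᵢ (z - φᵢ z)` would satisfy
`ε |D w| ≤ C / ‖K_w‖ = C √(1 - |w|²)`. The maximum principle gives `D = 0`
(`eq_zero_of_norm_le_sqrt`), so by the identity theorem some `φᵢ` would be the identity.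
-/

open Filter Topology ComplexConjugate

noncomputable section

/-! ### Estimates for finite sums of point evaluations -/

section PointEvaluations

variable {X ι : Type*} [Fintype ι] {ψ a : ι → X → ℂ} {N : X → ℝ}

/-- If the functional `p ↦ ∑ⱼ ψⱼ p(aⱼ)` is `O(N)` on monomials, then it is `O(N)` on the products of
a monomial and linear factors `X - aᵢ`, although these vary with the point of `X`: the `aᵢ` are
bounded. -/
theorem exists_norm_sum_mul_prod_sub_le (ha : ∀ j w, ‖a j w‖ ≤ 1)
    (h : ∀ m : ℕ, ∃ C, ∀ w, ‖∑ j, ψ j w * a j w ^ m‖ ≤ C * N w) (s : Finset ι) :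
    ∀ m : ℕ, ∃ C, ∀ w, ‖∑ j, ψ j w * (a j w ^ m * ∏ i ∈ s, (a j w - a i w))‖ ≤ C * N w := by
  classical
  induction s using Finset.induction_on with
  | empty => simpa using h
  | insert i s hi ih =>
    intro m
    obtain ⟨C, hC⟩ := ih m
    obtain ⟨C', hC'⟩ := ih (m + 1)
    refine ⟨C' + C, fun w => ?_⟩
    have key : ∑ j, ψ j w * (a j w ^ m * ∏ k ∈ insert i s, (a j w - a k w)) =
        ∑ j, ψ j w * (a j w ^ (m + 1) * ∏ k ∈ s, (a j w - a k w)) -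
          a i w * ∑ j, ψ j w * (a j w ^ m * ∏ k ∈ s, (a j w - a k w)) := by
      rw [Finset.mul_sum, ← Finset.sum_sub_distrib]
      refine Finset.sum_congr rfl fun j _ => ?_
      rw [Finset.prod_insert hi]
      ring
    rw [key, add_mul]
    refine (norm_sub_le _ _).trans (add_le_add (hC' w) ?_)
    rw [norm_mul]
    exact (mul_le_of_le_one_left (norm_nonneg _) (ha i w)).trans (hC w)

/-- The identity `b (X - aᵢ) = (1 - b aᵢ) - (1 - b X)` exchanges, one at a time, the factors
`1 - b aᵢ` in front of the sum for factors `X - aᵢ` in the sum. -/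
theorem exists_norm_prod_mul_resolvent_le_add {b : X → ℂ} (ha : ∀ j w, ‖a j w‖ ≤ 1)
    (hb : ∀ w, ‖b w‖ ≤ 1) (hab : ∀ j w, 1 - b w * a j w ≠ 0) (hN : ∀ w, 0 ≤ N w)
    (h : ∀ m : ℕ, ∃ C, ∀ w, ‖∑ j, ψ j w * a j w ^ m‖ ≤ C * N w) (s : Finset ι) :
    ∃ C, 0 ≤ C ∧ ∀ w, ‖∏ i ∈ s, (1 - b w * a i w)‖ * ‖∑ j, ψ j w * (1 - b w * a j w)⁻¹‖ ≤
      ‖∑ j, ψ j w * ((∏ i ∈ s, (a j w - a i w)) * (1 - b w * a j w)⁻¹)‖ + C * N w := by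
  classical
  induction s using Finset.induction_on with
  | empty => exact ⟨0, le_rfl, fun w => by simp⟩
  | insert i s hi ih =>
    obtain ⟨C, hC0, hC⟩ := ih
    obtain ⟨C', hC'⟩ := exists_norm_sum_mul_prod_sub_le ha h s 0
    refine ⟨|C'| + 2 * C, by positivity, fun w => ?_⟩
    have key : (1 - b w * a i w) *
          ∑ j, ψ j w * ((∏ k ∈ s, (a j w - a k w)) * (1 - b w * a j w)⁻¹) =
        b w * ∑ j, ψ j w * ((∏ k ∈ insert i s, (a j w - a k w)) * (1 - b w * a j w)⁻¹) +
          ∑ j, ψ j w * (a j w ^ 0 * ∏ k ∈ s, (a j w - a k w)) := by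
      rw [Finset.mul_sum, Finset.mul_sum, ← Finset.sum_add_distrib]
      refine Finset.sum_congr rfl fun j _ => ?_
      rw [Finset.prod_insert hi]
      have := hab j w
      field_simp
      ring
    have h2 : ‖1 - b w * a i w‖ ≤ 2 := by
      refine (norm_sub_le _ _).trans ?_
      rw [norm_one, norm_mul]
      linarith [mul_le_one₀ (hb w) (norm_nonneg _) (ha i w)]
    have hkey := congrArg norm key
    rw [norm_mul] at hkey
    have h3 := hkey.trans_le (norm_add_le _ _)
    rw [norm_mul] at h3
    have h4 := h3.trans (add_le_add (mul_le_of_le_one_left (norm_nonneg _) (hb w))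
      ((hC' w).trans (mul_le_mul_of_nonneg_right (le_abs_self C') (hN w))))
    rw [Finset.prod_insert hi, norm_mul, mul_assoc]
    have h5 := mul_le_mul_of_nonneg_left (hC w) (norm_nonneg (1 - b w * a i w))
    have h6 := mul_le_mul_of_nonneg_right h2 (mul_nonneg hC0 (hN w))
    linarith

/-- If the functional `p ↦ ∑ⱼ ψⱼ p(aⱼ)` is `O(N)` on monomials, then its value at the function
`1 / (1 - b X)` becomes `O(N)` after multiplication with `∏ᵢ (1 - b aᵢ)`. -/
theorem exists_norm_prod_mul_resolvent_le {b : X → ℂ} (ha : ∀ j w, ‖a j w‖ ≤ 1)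
    (hb : ∀ w, ‖b w‖ ≤ 1) (hab : ∀ j w, 1 - b w * a j w ≠ 0) (hN : ∀ w, 0 ≤ N w)
    (h : ∀ m : ℕ, ∃ C, ∀ w, ‖∑ j, ψ j w * a j w ^ m‖ ≤ C * N w) :
    ∃ C, ∀ w, ‖∏ i, (1 - b w * a i w)‖ * ‖∑ j, ψ j w * (1 - b w * a j w)⁻¹‖ ≤ C * N w := by
  obtain ⟨C, -, hC⟩ := exists_norm_prod_mul_resolvent_le_add ha hb hab hN h Finset.univ
  refine ⟨C, fun w => (hC w).trans_eq ?_⟩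
  -- Every point `aⱼ` is a zero of the product of all linear factors.
  have h0 : ∀ j, ∏ i, (a j w - a i w) = 0 := fun j =>
    Finset.prod_eq_zero (Finset.mem_univ j) (sub_self _)
  simp [h0]

end PointEvaluations

/-! ### Analytic functions on the unit disc -/

/-- An analytic function on the disc that is `O(√(1 - |z|²))` tends to `0` at the boundary, so it
vanishes by the maximum principle on the discs of radius `r < 1`. -/
theorem eq_zero_of_norm_le_sqrt {f : ℂ → ℂ} {C : ℝ}
    (hf : AnalyticOnNhd ℂ f (Metric.ball 0 1))
    (h : ∀ z ∈ Metric.ball (0 : ℂ) 1, ‖f z‖ ≤ C * √(1 - ‖z‖ ^ 2)) :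
    ∀ z ∈ Metric.ball (0 : ℂ) 1, f z = 0 := by
  intro z hz
  rw [mem_ball_zero_iff] at hz
  have hbound : ∀ r ∈ Set.Ioo ‖z‖ 1, ‖f z‖ ≤ C * √(1 - r ^ 2) := by
    rintro r ⟨hzr, hr1⟩
    have hr0 : r ≠ 0 := ((norm_nonneg z).trans_lt hzr).ne'
    refine Complex.norm_le_of_forall_mem_frontier_norm_le (U := Metric.ball 0 r)
      Metric.isBounded_ball ?_ ?_ (subset_closure (mem_ball_zero_iff.2 hzr))
    · refine DifferentiableOn.diffContOnCl fun x hx => ?_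
      rw [closure_ball _ hr0] at hx
      exact (hf x (Metric.closedBall_subset_ball hr1 hx)).differentiableAt.differentiableWithinAt
    · intro x hx
      rw [frontier_ball _ hr0, mem_sphere_zero_iff_norm] at hx
      simpa [hx] using h x (by rw [mem_ball_zero_iff, hx]; exact hr1)
  have hlim : Tendsto (fun r : ℝ => C * √(1 - r ^ 2)) (𝓝[<] 1) (𝓝 0) := by
    have hc : Continuous fun r : ℝ => C * √(1 - r ^ 2) := by fun_prop
    simpa using (hc.tendsto 1).mono_left nhdsWithin_le_nhds
  have := ge_of_tendsto hlim (eventually_of_mem (Ioo_mem_nhdsLT hz) hbound)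
  exact norm_le_zero_iff.1 this

/-- The ring of analytic functions on the disc has no zero divisors, stated for finite products. -/
theorem exists_eq_zero_of_prod_eq_zero {ι : Type*} [Fintype ι] {g : ι → ℂ → ℂ}
    (hg : ∀ i, AnalyticOnNhd ℂ (g i) (Metric.ball 0 1))
    (h : ∀ z ∈ Metric.ball (0 : ℂ) 1, ∏ i, g i z = 0) :
    ∃ i, ∀ z ∈ Metric.ball (0 : ℂ) 1, g i z = 0 := by
  by_contra! hne
  have h0 : (0 : ℂ) ∈ Metric.ball (0 : ℂ) 1 := Metric.mem_ball_self one_pos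
  have hev : ∀ i, ∀ᶠ z in 𝓝[≠] (0 : ℂ), g i z ≠ 0 := by
    intro i
    refine (hg i 0 h0).eventually_eq_zero_or_eventually_ne_zero.resolve_left fun hz => ?_
    obtain ⟨z, hz1, hz2⟩ := hne i
    exact hz2 ((hg i).eqOn_zero_of_preconnected_of_eventuallyEq_zero
      (convex_ball 0 1).isPreconnected h0 hz hz1)
  have hball : ∀ᶠ z in 𝓝[≠] (0 : ℂ), z ∈ Metric.ball (0 : ℂ) 1 :=
    nhdsWithin_le_nhds (Metric.isOpen_ball.mem_nhds h0)
  obtain ⟨z, hz, hzb⟩ := ((eventually_all.2 hev).and hball).exists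
  exact Finset.prod_ne_zero_iff.2 (fun i _ => hz i) (h z hzb)

/-- The pseudo-hyperbolic distance of two points of the disc is at most `1`. -/
theorem norm_sub_le_norm_one_sub_conj_mul {z w : ℂ} (hz : ‖z‖ ≤ 1) (hw : ‖w‖ ≤ 1) :
    ‖w - z‖ ≤ ‖1 - conj w * z‖ := by
  have hz2 : z.re * z.re + z.im * z.im ≤ 1 := by
    rw [← Complex.normSq_apply, Complex.normSq_eq_norm_sq]
    exact pow_le_one₀ (norm_nonneg z) hz
  have hw2 : w.re * w.re + w.im * w.im ≤ 1 := by
    rw [← Complex.normSq_apply, Complex.normSq_eq_norm_sq]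
    exact pow_le_one₀ (norm_nonneg w) hw
  refine le_of_sq_le_sq ?_ (norm_nonneg _)
  rw [← Complex.normSq_eq_norm_sq, ← Complex.normSq_eq_norm_sq, Complex.normSq_apply,
    Complex.normSq_apply]
  simp only [Complex.sub_re, Complex.sub_im, Complex.mul_re, Complex.mul_im, Complex.conj_re,
    Complex.conj_im, Complex.one_re, Complex.one_im]
  -- The difference of the two squares is `(1 - |w|²) (1 - |z|²)`.
  linarith [mul_nonneg (sub_nonneg.2 hw2) (sub_nonneg.2 hz2)]

/-! ### Monomials and reproducing kernels of the Hardy space -/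

namespace HardySpace

theorem coeffs_symm_hasSum (a : SquareSummableSeq) (z : 𝔻) :
    HasSum (fun n => a n * (z : ℂ) ^ n) ((coeffs.symm a : HardySpace) z) := by
  simpa using hasSum_coeffs (coeffs.symm a) z

/-- The function `z ↦ zᵐ`. -/
def monomial (m : ℕ) : HardySpace := coeffs.symm (lp.single 2 m 1)

theorem monomial_apply (m : ℕ) (z : 𝔻) : monomial m z = (z : ℂ) ^ m := by
  refine (coeffs_symm_hasSum _ z).unique ?_
  convert hasSum_ite_eq m ((z : ℂ) ^ m) using 2 with n
  by_cases h : n = m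
  · subst h; simp
  · simp [h]

theorem memℓp_conj_pow (w : 𝔻) : Memℓp (fun n : ℕ => conj (w : ℂ) ^ n) 2 := by
  refine memℓp_gen ?_
  have h1 : ‖(w : ℂ)‖ ^ 2 < 1 := pow_lt_one₀ (norm_nonneg _) w.norm_lt_one two_ne_zero
  refine (summable_geometric_of_lt_one (by positivity) h1).congr fun n => ?_
  simp [← pow_mul, mul_comm]

/-- The reproducing kernel `z ↦ 1 / (1 - conj w * z)` at the point `w`, given by its Taylor
coefficients `conj wⁿ`. -/
def kernel (w : 𝔻) : HardySpace := coeffs.symm ⟨fun n => conj (w : ℂ) ^ n, memℓp_conj_pow w⟩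

theorem norm_conj_mul_lt_one (w z : 𝔻) : ‖conj (w : ℂ) * z‖ < 1 := by
  rw [norm_mul, RCLike.norm_conj]
  exact mul_lt_one_of_nonneg_of_lt_one_left (norm_nonneg _) w.norm_lt_one z.norm_lt_one.le

theorem one_sub_conj_mul_ne_zero (w z : 𝔻) : 1 - conj (w : ℂ) * z ≠ 0 := by
  intro h
  have h1 := norm_conj_mul_lt_one w z
  rw [← sub_eq_zero.1 h, norm_one] at h1
  exact lt_irrefl _ h1

theorem kernel_apply (w z : 𝔻) : kernel w z = (1 - conj (w : ℂ) * z)⁻¹ := by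
  refine (coeffs_symm_hasSum _ z).unique ?_
  simpa only [mul_pow] using hasSum_geometric_of_norm_lt_one (norm_conj_mul_lt_one w z)

theorem inner_kernel_left (w : 𝔻) (f : HardySpace) : inner ℂ (kernel w) f = f w := by
  change inner ℂ (coeffs (kernel w)) (coeffs f) = f w
  refine (lp.hasSum_inner _ _).unique ?_
  have h : ∀ n, inner ℂ (coeffs (kernel w) n) (coeffs f n) = coeffs f n * (w : ℂ) ^ n := fun n => by
    rw [kernel, LinearEquiv.apply_symm_apply, RCLike.inner_apply, map_pow,
      Complex.conj_conj]
  simpa only [h] using hasSum_coeffs f w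

theorem norm_apply_le (w : 𝔻) (f : HardySpace) : ‖f w‖ ≤ ‖f‖ * ‖kernel w‖ := by
  rw [← inner_kernel_left, mul_comm]
  exact norm_inner_le_norm _ _

theorem one_sub_norm_sq_pos (w : 𝔻) : 0 < 1 - ‖(w : ℂ)‖ ^ 2 :=
  sub_pos.2 (pow_lt_one₀ (norm_nonneg _) w.norm_lt_one two_ne_zero)

theorem norm_kernel (w : 𝔻) : ‖kernel w‖ = (√(1 - ‖(w : ℂ)‖ ^ 2))⁻¹ := by
  have h : ((‖kernel w‖ ^ 2 : ℝ) : ℂ) = ((1 - ‖(w : ℂ)‖ ^ 2)⁻¹ : ℝ) := by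
    have h1 := inner_self_eq_norm_sq_to_K (𝕜 := ℂ) (kernel w)
    rw [inner_kernel_left, kernel_apply, Complex.conj_mul'] at h1
    push_cast
    exact h1.symm
  rw [← Real.sqrt_inv, ← Complex.ofReal_inj.1 h, Real.sqrt_sq (norm_nonneg _)]

theorem norm_kernel_pos (w : 𝔻) : 0 < ‖kernel w‖ := by
  rw [norm_kernel]
  exact inv_pos.2 (Real.sqrt_pos.2 (one_sub_norm_sq_pos w))

/-- The numerical range contains the Berezin transform of the operator. -/
theorem apply_kernel_div_mem_numericalRange (T : HardySpace →ₗ[ℂ] HardySpace) (w : 𝔻) :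
    T (kernel w) w / (‖kernel w‖ : ℂ) ^ 2 ∈ numericalRange T := by
  have h0 : (‖kernel w‖ : ℂ) ≠ 0 := Complex.ofReal_ne_zero.2 (norm_kernel_pos w).ne'
  refine ⟨(‖kernel w‖ : ℂ)⁻¹ • kernel w, ?_, ?_⟩
  · rw [norm_smul, norm_inv, Complex.norm_real, norm_norm,
      inv_mul_cancel₀ (norm_kernel_pos w).ne']
  · rw [map_smul, inner_smul_left, inner_smul_right, inner_kernel_left, map_inv₀,
      Complex.conj_ofReal]
    field_simp

end HardySpace

/-! ### Sums of weighted composition operators -/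

open HardySpace

theorem weightedCompSumHardy_apply {n : ℕ} (ψ : Fin n → 𝔻 → ℂ) (φ : Fin n → 𝔻 → 𝔻)
    (hM : ∀ f ∈ hardySubmodule, weightedCompSum ψ φ f ∈ hardySubmodule) (f : HardySpace) (w : 𝔻) :
    weightedCompSumHardy ψ φ hM f w = ∑ j, ψ j w * f (φ j w) := by
  change weightedCompSum ψ φ f w = _
  simp [weightedCompSum, weightedComp]

/-- The Berezin transform of `M` at `w`, times `∏ⱼ (w - φⱼ w)`, is `O(√(1 - |w|²))`; here both
sides are multiplied by `‖K_w‖²`. -/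
theorem exists_norm_prod_mul_apply_kernel_le {n : ℕ} (φ : Fin n → 𝔻 → 𝔻) (ψ : Fin n → 𝔻 → ℂ)
    (hM : ∀ f ∈ hardySubmodule, weightedCompSum ψ φ f ∈ hardySubmodule) :
    ∃ C, ∀ w : 𝔻, ‖∏ j, ((w : ℂ) - φ j w)‖ * ‖weightedCompSumHardy ψ φ hM (kernel w) w‖ ≤
      C * ‖kernel w‖ := by
  obtain ⟨C, hC⟩ := exists_norm_prod_mul_resolvent_le (ψ := ψ) (a := fun j w => (φ j w : ℂ))
    (b := fun w : 𝔻 => conj (w : ℂ)) (N := fun w => ‖kernel w‖)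
    (fun j w => (φ j w).norm_lt_one.le)
    (fun w => (RCLike.norm_conj (w : ℂ)).trans_le w.norm_lt_one.le)
    (fun j w => one_sub_conj_mul_ne_zero w (φ j w)) (fun w => norm_nonneg _)
    (fun m => ⟨‖weightedCompSumHardy ψ φ hM (monomial m)‖, fun w => by
      simpa only [weightedCompSumHardy_apply, monomial_apply] using
        norm_apply_le w (weightedCompSumHardy ψ φ hM (monomial m))⟩)
  refine ⟨C, fun w => le_trans ?_ (hC w)⟩
  simp only [weightedCompSumHardy_apply, kernel_apply, norm_prod]
  gcongr with j
  exact norm_sub_le_norm_one_sub_conj_mul (φ j w).norm_lt_one.le w.norm_lt_one.le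

end

theorem mainTheorem5 (n : ℕ) (φ : Fin n → 𝔻 → 𝔻) (ψ : Fin n → 𝔻 → ℂ)
    (hφ : ∀ j, IsAnalyticOnDisc (fun z => (φ j z : ℂ)))
    (hφ_ne : ∀ j, φ j ≠ id)
    (hψ : ∀ j, IsAnalyticOnDisc (ψ j))
    (hM : ∀ f ∈ hardySubmodule, weightedCompSum ψ φ f ∈ hardySubmodule) :
    (0 : ℂ) ∈ closure (numericalRange (weightedCompSumHardy ψ φ hM)) := by
  by_contra hcl
  obtain ⟨ε, hε, hdist⟩ : ∃ ε > 0, ∀ z ∈ numericalRange (weightedCompSumHardy ψ φ hM), ε ≤ ‖z‖ := by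
    simpa [Metric.mem_closure_iff] using hcl
  obtain ⟨C, hC⟩ := exists_norm_prod_mul_apply_kernel_le φ ψ hM
  choose g hg hgφ using hφ
  replace hgφ : ∀ j (w : 𝔻), (φ j w : ℂ) = g j w := hgφ
  obtain ⟨j, hj⟩ := exists_eq_zero_of_prod_eq_zero (g := fun j z => z - g j z)
    (fun j => analyticOnNhd_id.sub (hg j)) <| by
    refine eq_zero_of_norm_le_sqrt (C := C / ε)
      (Finset.analyticOnNhd_fun_prod _ fun j _ => analyticOnNhd_id.sub (hg j)) fun z hz => ?_
    obtain ⟨w, rfl⟩ : ∃ w : 𝔻, (w : ℂ) = z :=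
      ⟨Complex.UnitDisc.mk z (mem_ball_zero_iff.1 hz), rfl⟩
    have hK := HardySpace.norm_kernel_pos w
    have h1 := hdist _ (HardySpace.apply_kernel_div_mem_numericalRange _ w)
    rw [norm_div, norm_pow, Complex.norm_real, norm_norm, le_div_iff₀ (by positivity)] at h1
    have h2 := (mul_le_mul_of_nonneg_left h1 (norm_nonneg _)).trans (hC w)
    rw [← inv_inv √(1 - ‖(w : ℂ)‖ ^ 2), ← HardySpace.norm_kernel, ← div_eq_mul_inv,
      div_div, le_div_iff₀ (by positivity)]
    simp only [← hgφ]
    refine le_of_mul_le_mul_right ?_ hK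
    linarith
  refine hφ_ne j (funext fun w => Complex.UnitDisc.coe_injective ?_)
  have := hj w (mem_ball_zero_iff.2 w.norm_lt_one)
  rw [id, hgφ]
  exact (sub_eq_zero.1 this).symm
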